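/- Let $k$ be an algebraically closed field of arbitrary characteristic, let $n\ge 3$ and $d_1,\dots,d_n\ge 1$ be integers, let $F=X_1^{d_1}+\dots+X_n^{d_n}\in k[X_1,\dots,X_n]$, and let $Z=V(F)=\operatorname{Spec} k[X_1,\dots,X_n]/(F)\subset\mathbb{A}^n_k$. Assume that there is at most one index $i$ such that $\operatorname{char} k$ divides $d_i$. For $m\ge 0$ let $Z_m$ be the $m$-th jet scheme of $Z$, that is, the $k$-scheme whose $A$-valued points are, naturally in the $k$-algebra $A$, the $A[t]/(t^{m+1})$-valued points of $Z$. Explicitly, $Z_m$ is the closed subscheme of $\mathbb{A}_k^{(m+1)n}$, with coordinates $X_i^{(j)}$ $(1\le i\le n,\ 0\le j\le m)$, defined by the coefficients of $t^0,\dots,t^m$ in $F\bigl(\sum_{j=0}^m X_1^{(j)}t^j,\dots,\sum_{j=0}^m X_n^{(j)}t^j\bigr)$. Then $Z_m$ is irreducible for all $m\ge 1$ if and only if $$\sum_{i=1}^n\frac1{d_i}>1.$$ -/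

import Mathlib

universe u v w

open AlgebraicGeometry

/-- The truncated polynomial ring `A[t]/(t^(m+1))`. -/
abbrev TruncPoly (A : Type w) [CommRing A] (m : ℕ) : Type w :=
  Polynomial A ⧸ Ideal.span {(Polynomial.X : Polynomial A) ^ (m + 1)}

/-- The map `B[t]/(t^(m+1)) → A[t]/(t^(m+1))` induced on coefficients by `φ : B → A`. -/
noncomputable def TruncPoly.map {k : Type u} [CommRing k] {B : Type v} [CommRing B] [Algebra k B]
    {A : Type w} [CommRing A] [Algebra k A] (m : ℕ) (φ : B →ₐ[k] A) :
    TruncPoly B m →ₐ[k] TruncPoly A m :=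
  Ideal.quotientMapₐ _ (Polynomial.mapAlgHom φ) (by
    rw [Ideal.span_le, Set.singleton_subset_iff]
    refine Ideal.mem_comap.mpr (Ideal.mem_span_singleton.mpr ?_)
    simp)

section Jets

variable {k : Type u} [CommRing k] {σ : Type v}

/-- The `k`-algebra map `k[U_i] → k[U_i^(j) : i ∈ σ, 0 ≤ j ≤ m][t]` which sends `U_i` to
`∑_{j ≤ m} U_i^(j) t^j`. -/
noncomputable def genericJet (k : Type u) [CommRing k] (σ : Type v) (m : ℕ) :
    MvPolynomial σ k →ₐ[k] Polynomial (MvPolynomial (σ × Fin (m + 1)) k) :=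
  MvPolynomial.aeval fun i => ∑ j : Fin (m + 1),
    Polynomial.C (MvPolynomial.X (i, j)) * Polynomial.X ^ (j : ℕ)

/-- The equations of the `m`-th jet scheme of `V(I)`: the coefficients of `t^j`, `0 ≤ j ≤ m`, in
`f (∑_j U_1^(j) t^j, ∑_j U_2^(j) t^j, …)`, for all `f ∈ I`. -/
noncomputable def jetIdeal (I : Ideal (MvPolynomial σ k)) (m : ℕ) :
    Ideal (MvPolynomial (σ × Fin (m + 1)) k) :=
  Ideal.span {g | ∃ f ∈ I, ∃ j ≤ m, g = (genericJet k σ m f).coeff j}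

/-- The coordinate ring of the `m`-th jet scheme of `V(I) = Spec (k[U]/I)`. -/
abbrev JetRing (I : Ideal (MvPolynomial σ k)) (m : ℕ) : Type (max u v) :=
  MvPolynomial (σ × Fin (m + 1)) k ⧸ jetIdeal I m

/-- The `m`-th jet scheme `X_m` of the affine scheme `X = V(I) = Spec (k[U]/I)`. It is characterized
by the universal property `jetRing_universal` below. -/
noncomputable def jetScheme (I : Ideal (MvPolynomial σ k)) (m : ℕ) : Scheme.{max u v} :=
  Spec (CommRingCat.of (JetRing I m))

/-- The universal `m`-jet on `V(I)`, with coordinates `U_i ↦ ∑_{j ≤ m} U_i^(j) t^j`. -/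
noncomputable def universalJet (I : Ideal (MvPolynomial σ k)) (m : ℕ) :
    (MvPolynomial σ k ⧸ I) →ₐ[k] TruncPoly (JetRing I m) m :=
  Ideal.Quotient.liftₐ I
    ((Ideal.Quotient.mkₐ k _).comp
      ((Polynomial.mapAlgHom (Ideal.Quotient.mkₐ k (jetIdeal I m))).comp (genericJet k σ m)))
    (by
      intro f hf
      refine Ideal.Quotient.eq_zero_iff_mem.mpr
        (Ideal.mem_span_singleton.mpr (Polynomial.X_pow_dvd_iff.mpr fun j hj => ?_))
      change (Polynomial.map _ _).coeff j = 0
      rw [Polynomial.coeff_map]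
      exact Ideal.Quotient.eq_zero_iff_mem.mpr
        (Ideal.subset_span ⟨f, hf, j, Nat.lt_succ_iff.mp hj, rfl⟩))

/-- The universal property of the jet scheme: for every `k`-algebra `A`, the `A`-valued points of
`X_m` correspond, by pulling back the universal jet and hence naturally in `A`, to the
`A[t]/(t^(m+1))`-valued points of `X`. -/
theorem jetRing_universal (I : Ideal (MvPolynomial σ k)) (m : ℕ)
    (A : Type w) [CommRing A] [Algebra k A] :
    Function.Bijective fun φ : JetRing I m →ₐ[k] A =>
      (TruncPoly.map m φ).comp (universalJet I m) := by
  have key : ∀ (φ : MvPolynomial (σ × Fin (m + 1)) k →ₐ[k] A) (i : σ),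
      Polynomial.mapAlgHom φ (genericJet k σ m (MvPolynomial.X i)) =
        ∑ j : Fin (m + 1), Polynomial.C (φ (MvPolynomial.X (i, j))) * Polynomial.X ^ (j : ℕ) := by
    intro φ i
    simp [genericJet, map_sum]
  have coeff_key : ∀ (c : Fin (m + 1) → A) (j : Fin (m + 1)),
      (∑ j : Fin (m + 1), Polynomial.C (c j) * Polynomial.X ^ (j : ℕ)).coeff (j : ℕ) = c j := by
    intro c j
    simp [Polynomial.coeff_X_pow, Fin.val_inj]
  constructor
  · intro φ ψ h
    refine Ideal.Quotient.algHom_ext k (MvPolynomial.algHom_ext fun ⟨i, j⟩ => ?_)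
    have h1 := congrArg (fun g => g (Ideal.Quotient.mk I (MvPolynomial.X i))) h
    have h2 : Ideal.Quotient.mk (Ideal.span {(Polynomial.X : Polynomial A) ^ (m + 1)})
        (Polynomial.mapAlgHom (φ.comp (Ideal.Quotient.mkₐ k _))
          (genericJet k σ m (MvPolynomial.X i))) =
        Ideal.Quotient.mk _ (Polynomial.mapAlgHom (ψ.comp (Ideal.Quotient.mkₐ k _))
          (genericJet k σ m (MvPolynomial.X i))) := by
      rw [← Polynomial.mapAlgHom_comp, ← Polynomial.mapAlgHom_comp]
      exact h1
    rw [key, key, Ideal.Quotient.eq, Ideal.mem_span_singleton, Polynomial.X_pow_dvd_iff] at h2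
    have h3 := h2 j j.2
    rw [Polynomial.coeff_sub, coeff_key, coeff_key, sub_eq_zero] at h3
    exact h3
  · intro g
    have hex : ∀ i : σ, ∃ p : Polynomial A,
        Ideal.Quotient.mk _ p = g (Ideal.Quotient.mk I (MvPolynomial.X i)) :=
      fun i => Ideal.Quotient.mk_surjective _
    choose p hp using hex
    let φ₀ : MvPolynomial (σ × Fin (m + 1)) k →ₐ[k] A :=
      MvPolynomial.aeval fun x => (p x.1).coeff x.2
    have hφ : ((Ideal.Quotient.mkₐ k (Ideal.span {(Polynomial.X : Polynomial A) ^ (m + 1)})).comp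
        ((Polynomial.mapAlgHom φ₀).comp (genericJet k σ m))) =
        g.comp (Ideal.Quotient.mkₐ k I) := by
      refine MvPolynomial.algHom_ext fun i => ?_
      change Ideal.Quotient.mk _ (Polynomial.mapAlgHom φ₀ (genericJet k σ m (MvPolynomial.X i))) =
        g (Ideal.Quotient.mk I (MvPolynomial.X i))
      rw [← hp i, key, Ideal.Quotient.eq, Ideal.mem_span_singleton, Polynomial.X_pow_dvd_iff]
      intro j hj
      rw [Polynomial.coeff_sub, coeff_key _ ⟨j, hj⟩]
      simp [φ₀]
    have hker : ∀ a ∈ jetIdeal I m, φ₀ a = 0 := by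
      intro a ha
      have hle : jetIdeal I m ≤ RingHom.ker φ₀ := by
        refine Ideal.span_le.mpr ?_
        rintro _ ⟨f, hf, j, hj, rfl⟩
        have h1 := congrArg (fun h => h f) hφ
        have h2 : Ideal.Quotient.mk (Ideal.span {(Polynomial.X : Polynomial A) ^ (m + 1)})
            (Polynomial.mapAlgHom φ₀ (genericJet k σ m f)) = 0 := by
          refine h1.trans ?_
          change g (Ideal.Quotient.mk I f) = 0
          rw [Ideal.Quotient.eq_zero_iff_mem.mpr hf, map_zero]
        rw [Ideal.Quotient.eq_zero_iff_mem, Ideal.mem_span_singleton,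
          Polynomial.X_pow_dvd_iff] at h2
        have h3 := h2 j (Nat.lt_succ_of_le hj)
        rw [Polynomial.coe_mapAlgHom, Polynomial.coeff_map] at h3
        exact h3
      exact hle ha
    refine ⟨Ideal.Quotient.liftₐ _ φ₀ hker, ?_⟩
    refine Ideal.Quotient.algHom_ext k ?_
    rw [← hφ]
    refine MvPolynomial.algHom_ext fun i => ?_
    change Ideal.Quotient.mk _ (Polynomial.mapAlgHom (Ideal.Quotient.liftₐ _ φ₀ hker)
      (Polynomial.mapAlgHom (Ideal.Quotient.mkₐ k (jetIdeal I m))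
        (genericJet k σ m (MvPolynomial.X i)))) =
      Ideal.Quotient.mk _ (Polynomial.mapAlgHom φ₀ (genericJet k σ m (MvPolynomial.X i)))
    rw [← AlgHom.comp_apply, Polynomial.mapAlgHom_comp, Ideal.Quotient.liftₐ_comp]

end Jets

/-- The polynomial `F = X_1^{d_1} + … + X_n^{d_n}` over `k`. -/
noncomputable def diagonalPoly (k : Type u) [CommRing k] {n : ℕ} (d : Fin n → ℕ) :
    MvPolynomial (Fin n) k :=
  ∑ i, MvPolynomial.X i ^ d i

/-! Let P be a prime containing the jet ideal, with generic jet (p_l) over the fraction field of its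
residue ring. Let a_l be the t-order of p_l, capped at m+1, and e = min(m+1, min a_l d_l). At most
n(m+1) - Σ a_l coefficients are nonzero. After division by t^e the equation still has m+1-e
coefficients, and these make as many coefficients of a single p_i algebraic over the rest. Hence
height P ≥ Σ a_l + (m+1-e) (`exists_orders_sum_add_le_height`).

If P is minimal, Krull's theorem gives height P ≤ m+1, so Σ a_l ≤ e. Since a_l ≥ e/d_l, it follows
that e Σ 1/d_l ≤ e. If Σ 1/d_l > 1, then e = 0 and every a_l = 0: no component of Z_m lies over a
coordinate hyperplane. For d_i invertible in k, the jets with X_i^(0) ≠ 0 lie in one irreducible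
closed subset of Z_m, because F is prime and Hensel lifting solves for the i-th coordinate
(`exists_prime_le_of_X_notMem`). So Z_m is irreducible.

If Σ 1/d_l ≤ 1, take m+1 = ∏ d_i. The linear space where X_l^(j) = 0 for j < (m+1)/d_l lies in Z_m
and has codimension at most m+1. An irreducible Z_m lies in no hyperplane X_i^(0) = 0, so by the
height bound it has codimension at least m+1; yet it properly contains that linear space, a
contradiction. -/

/-! ### Heights and transcendence degrees in polynomial rings. -/

/-- The height of a prime plus the transcendence degree of its residue ring grows by at least one
when a variable is added. -/
theorem Polynomial.height_add_trdeg_comap_C_add_one_le {k A : Type u} [Field k] [CommRing A]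
    [IsNoetherianRing A] [Algebra k A] (P : Ideal (Polynomial A)) [P.IsPrime] :
    (P.comap Polynomial.C).height +
        Cardinal.toENat (Algebra.trdeg k (A ⧸ P.comap Polynomial.C)) + 1 ≤
      P.height + Cardinal.toENat (Algebra.trdeg k (Polynomial A ⧸ P)) := by
  set p := P.comap (Polynomial.C : A →+* Polynomial A) with hp
  have hpP : p.IsPrime := Ideal.comap_isPrime _ _
  have hmapP : (p.map Polynomial.C).IsPrime := Ideal.isPrime_map_C_of_isPrime
  have hle : p.map Polynomial.C ≤ P := Ideal.map_comap_le
  have hht : p.height ≤ (p.map Polynomial.C).height := by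
    have : (p.map (Polynomial.C : A →+* Polynomial A)).LiesOver p :=
      ⟨by ext x; simp [Ideal.under, Ideal.mem_map_C_iff, Polynomial.coeff_C, apply_ite]⟩
    -- Going down for `A → A[X]` keeps heights from dropping under extension.
    rw [Ideal.height_eq_height_add_of_liesOver_of_hasGoingDown p (p.map Polynomial.C)]
    exact le_self_add
  -- Either `P` is extended from `A` and the residue ring gains a variable, or `P` is strictly
  -- larger than the extension of `p` and the height gains one.
  rcases hle.eq_or_lt with h | h
  · have htr : Algebra.trdeg k (A ⧸ p) + 1 ≤ Algebra.trdeg k (Polynomial A ⧸ P) := by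
      let φ : (Polynomial A ⧸ P) →ₐ[k] Polynomial (A ⧸ p) :=
        Ideal.Quotient.liftₐ P (Polynomial.mapAlgHom (Ideal.Quotient.mkₐ k p)) (by
          intro f hf
          rw [← h, Ideal.mem_map_C_iff] at hf
          ext j
          simpa using Ideal.Quotient.eq_zero_iff_mem.mpr (hf j))
      have hφ : Function.Surjective φ := by
        intro g
        obtain ⟨f, rfl⟩ := Polynomial.map_surjective (Ideal.Quotient.mk p)
          Ideal.Quotient.mk_surjective g
        exact ⟨Ideal.Quotient.mk P f, rfl⟩
      calc Algebra.trdeg k (A ⧸ p) + 1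
          = Algebra.trdeg k (A ⧸ p) + Algebra.trdeg (A ⧸ p) (Polynomial (A ⧸ p)) := by
            rw [Polynomial.trdeg_of_isDomain]
        _ ≤ Algebra.trdeg k (Polynomial (A ⧸ p)) := trdeg_add_le
        _ ≤ _ := trdeg_le_of_surjective φ hφ
    have h2 := OrderHomClass.mono Cardinal.toENat htr
    rw [map_add, map_one] at h2
    rw [add_assoc]
    exact add_le_add (hht.trans (Ideal.height_mono hle)) h2
  · have htr : Algebra.trdeg k (A ⧸ p) ≤ Algebra.trdeg k (Polynomial A ⧸ P) :=
      trdeg_le_of_injective (Ideal.quotientMapₐ P (Polynomial.CAlgHom (R := k) (A := A)) le_rfl)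
        (Ideal.quotientMap_injective (I := P) (f := (Polynomial.C : A →+* Polynomial A)))
    have h2 := OrderHomClass.mono Cardinal.toENat htr
    rw [add_right_comm]
    refine add_le_add ?_ h2
    exact (add_le_add_left hht 1).trans (Ideal.height_add_one_le_of_lt_of_isPrime h)

theorem MvPolynomial.card_le_height_add_trdeg_fin {k : Type u} [Field k] (N : ℕ)
    (P : Ideal (MvPolynomial (Fin N) k)) [P.IsPrime] :
    (N : ℕ∞) ≤ P.height + Cardinal.toENat (Algebra.trdeg k (MvPolynomial (Fin N) k ⧸ P)) := by
  induction N with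
  | zero => simp
  | succ N ih =>
    let e := MvPolynomial.finSuccEquiv k N
    let Q := P.comap e.symm.toRingEquiv.toRingHom
    have hQ : Q.IsPrime := Ideal.comap_isPrime _ _
    have h1 := Polynomial.height_add_trdeg_comap_C_add_one_le (k := k) Q
    have h2 := ih (Q.comap Polynomial.C)
    have h3 : Q.height = P.height := RingEquiv.height_comap e.symm.toRingEquiv P
    have h4 : Algebra.trdeg k (Polynomial (MvPolynomial (Fin N) k) ⧸ Q) ≤
        Algebra.trdeg k (MvPolynomial (Fin (N + 1)) k ⧸ P) :=
      trdeg_le_of_injective (Ideal.quotientMapₐ P e.symm.toAlgHom le_rfl)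
        (Ideal.quotientMap_injective (I := P) (f := e.symm.toRingEquiv.toRingHom))
    rw [h3] at h1
    push_cast
    calc (N : ℕ∞) + 1 ≤ _ := add_le_add_left h2 1
      _ ≤ _ := h1
      _ ≤ _ := add_le_add_right (OrderHomClass.mono Cardinal.toENat h4) _

/-- A lower bound for the height of a prime in a polynomial ring over a field. -/
theorem MvPolynomial.card_le_height_add_trdeg {k : Type u} [Field k] {σ : Type} [Fintype σ]
    (P : Ideal (MvPolynomial σ k)) [P.IsPrime] :
    (Fintype.card σ : ℕ∞) ≤
      P.height + Cardinal.toENat (Algebra.trdeg k (MvPolynomial σ k ⧸ P)) := by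
  let e := MvPolynomial.renameEquiv k (Fintype.equivFin σ)
  let Q := P.comap e.symm.toRingEquiv.toRingHom
  have hQ : Q.IsPrime := Ideal.comap_isPrime _ _
  have h2 := MvPolynomial.card_le_height_add_trdeg_fin _ Q
  have h3 : Q.height = P.height := RingEquiv.height_comap e.symm.toRingEquiv P
  have h4 : Algebra.trdeg k (MvPolynomial (Fin (Fintype.card σ)) k ⧸ Q) ≤
      Algebra.trdeg k (MvPolynomial σ k ⧸ P) :=
    trdeg_le_of_injective (Ideal.quotientMapₐ P e.symm.toAlgHom le_rfl)
      (Ideal.quotientMap_injective (I := P) (f := e.symm.toRingEquiv.toRingHom))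
  rw [h3] at h2
  exact h2.trans (add_le_add_right (OrderHomClass.mono Cardinal.toENat h4) _)

/-! ### Roots modulo a power of the variable. -/

open Polynomial in
/-- Hensel lifting of a `d`-th root modulo `X ^ s`. -/
theorem Polynomial.exists_X_pow_dvd_pow_add {R : Type*} [CommRing R] (q : R[X]) (d : ℕ) (r : R)
    (hr : r ^ d + q.coeff 0 = 0) (hu : IsUnit ((d : R) * r ^ (d - 1))) (s : ℕ) :
    ∃ v : R[X], v.coeff 0 = r ∧ X ^ s ∣ v ^ d + q := by
  induction s with
  | zero => exact ⟨C r, by simp, by simp⟩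
  | succ s ih =>
    obtain ⟨v, hv, w, hw⟩ := ih
    rcases Nat.eq_zero_or_pos s with rfl | hs
    · refine ⟨v, hv, ?_⟩
      rw [zero_add, pow_one, X_dvd_iff]
      rw [coeff_add, coeff_zero_eq_eval_zero, eval_pow, ← coeff_zero_eq_eval_zero, hv, hr]
    obtain ⟨c, hc⟩ := hu.exists_right_inv
    -- Newton correction: `c` inverts the derivative `d * r ^ (d - 1)`, and the new term cancels the
    -- coefficient of `X ^ s` in the error.
    refine ⟨v + C (-(c * w.coeff 0)) * X ^ s, ?_, ?_⟩
    · simp [hv, coeff_X_pow, hs.ne]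
    · obtain ⟨z, hz⟩ := Polynomial.powAddExpansion v (C (-(c * w.coeff 0)) * X ^ s) d
      have h1 : X ∣ w + (d : R[X]) * v ^ (d - 1) * C (-(c * w.coeff 0)) := by
        rw [X_dvd_iff, coeff_zero_eq_eval_zero]
        simp only [eval_add, eval_mul, eval_pow, eval_C, eval_natCast]
        rw [← coeff_zero_eq_eval_zero, ← coeff_zero_eq_eval_zero, hv]
        linear_combination (-w.coeff 0) * hc
      rw [hz]
      have h2 : v ^ d + (d : R[X]) * v ^ (d - 1) * (C (-(c * w.coeff 0)) * X ^ s) +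
          z * (C (-(c * w.coeff 0)) * X ^ s) ^ 2 + q =
          X ^ s * (w + (d : R[X]) * v ^ (d - 1) * C (-(c * w.coeff 0))) +
          X ^ (s + s) * (z * C (-(c * w.coeff 0)) ^ 2) := by
        rw [pow_add]
        linear_combination hw
      rw [h2]
      refine dvd_add ?_ ((pow_dvd_pow _ (by omega)).mul_right _)
      rw [pow_succ]
      exact mul_dvd_mul_left _ h1

open Polynomial in
/-- Uniqueness of `d`-th roots modulo `X ^ s` with prescribed nonzero constant term. -/
theorem Polynomial.X_pow_dvd_sub_of_X_pow_dvd_pow_sub_pow {R : Type*} [CommRing R] [IsDomain R]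
    {v w : R[X]} {d s : ℕ} (h0 : v.coeff 0 = w.coeff 0) (hw : w.coeff 0 ≠ 0) (hd : (d : R) ≠ 0)
    (h : X ^ s ∣ v ^ d - w ^ d) : X ^ s ∣ v - w := by
  rw [← (Commute.all v w).mul_geom_sum₂] at h
  -- The cofactor of `v - w` has constant term `d * w₀ ^ (d - 1) ≠ 0`, so it is prime to `X`.
  refine (prime_X.pow_dvd_of_dvd_mul_right s ?_ h)
  rw [X_dvd_iff, coeff_zero_eq_eval_zero, eval_finsetSum]
  simp only [eval_mul, eval_pow, ← coeff_zero_eq_eval_zero, h0]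
  have : ∀ i ∈ Finset.range d, w.coeff 0 ^ i * w.coeff 0 ^ (d - 1 - i) = w.coeff 0 ^ (d - 1) := by
    intro i hi
    rw [← pow_add]
    congr 1
    have := Finset.mem_range.mp hi
    omega
  rw [Finset.sum_congr rfl this]
  simp [hd, hw]

/-! ### Primality of the diagonal polynomial. -/

theorem diagonalPoly_eval {k : Type u} [CommRing k] {n : ℕ} (d : Fin n → ℕ) (x : Fin n → k) :
    MvPolynomial.eval x (diagonalPoly k d) = ∑ i, x i ^ d i := by
  simp [diagonalPoly]

theorem not_isUnit_diagonalPoly {k : Type u} [Field k] {n : ℕ} (d : Fin n → ℕ)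
    (hd : ∀ i, 1 ≤ d i) : ¬ IsUnit (diagonalPoly k d) := by
  intro h
  have h1 := h.map (MvPolynomial.eval (0 : Fin n → k))
  rw [diagonalPoly_eval] at h1
  have h2 : ∀ i, d i ≠ 0 := fun i => Nat.one_le_iff_ne_zero.mp (hd i)
  simp [h2] at h1

theorem not_X_dvd_diagonalPoly {k : Type u} [Field k] {n : ℕ} (hn : 2 ≤ n) (d : Fin n → ℕ)
    (hd : ∀ i, 1 ≤ d i) (i : Fin n) : ¬ (MvPolynomial.X i : MvPolynomial (Fin n) k) ∣
      diagonalPoly k d := by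
  rintro ⟨g, hg⟩
  have : Nontrivial (Fin n) := Fin.nontrivial_iff_two_le.mpr hn
  obtain ⟨j, hj⟩ := exists_ne i
  have h := congrArg (MvPolynomial.eval (Pi.single j (1 : k))) hg
  rw [diagonalPoly_eval, Finset.sum_eq_single j] at h
  · simp [hj.symm] at h
  · intro b _ hb
    simp [hb, (Nat.one_le_iff_ne_zero.mp (hd b))]
  · simp

/-- A diagonal polynomial has a simple prime factor as soon as one of its exponents is invertible. -/
theorem exists_prime_dvd_diagonalPoly {k : Type u} [Field k] {n : ℕ} (hn : 2 ≤ n) (d : Fin n → ℕ)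
    (hd : ∀ i, 1 ≤ d i) (i : Fin n) (hi : (d i : k) ≠ 0) :
    ∃ π : MvPolynomial (Fin n) k, Prime π ∧ π ∣ diagonalPoly k d ∧ ¬ π ^ 2 ∣ diagonalPoly k d := by
  have h0 : diagonalPoly k d ≠ 0 := by
    intro h
    exact not_X_dvd_diagonalPoly hn d hd i (h ▸ dvd_zero _)
  obtain ⟨π, hπ, hdvd⟩ := WfDvdMonoid.exists_irreducible_factor
    (not_isUnit_diagonalPoly (k := k) d hd) h0
  refine ⟨π, hπ.prime, hdvd, ?_⟩
  rintro ⟨g, hg⟩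
  -- A double factor would divide this partial derivative, hence be associated to `X i`, which does
  -- not divide the polynomial.
  have h1 : MvPolynomial.pderiv i (diagonalPoly k d) =
      MvPolynomial.C (d i : k) * MvPolynomial.X i ^ (d i - 1) := by
    rw [diagonalPoly, map_sum, Finset.sum_eq_single i]
    · simp
    · intro j _ hj
      simp [MvPolynomial.pderiv_X_of_ne hj]
    · simp
  have h2 : π ∣ MvPolynomial.pderiv i (diagonalPoly k d) := by
    rw [hg, Derivation.leibniz, MvPolynomial.pderiv_pow, smul_eq_mul, smul_eq_mul]
    refine dvd_add ((dvd_pow_self _ two_ne_zero).mul_right _) (Dvd.dvd.mul_left ?_ _)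
    exact ((dvd_pow_self _ (by norm_num)).mul_left _).mul_right _
  rw [h1] at h2
  have h3 : π ∣ MvPolynomial.X i := by
    refine hπ.prime.dvd_of_dvd_pow ((hπ.prime.dvd_or_dvd h2).resolve_left fun h => ?_)
    exact hπ.not_isUnit (isUnit_of_dvd_unit h ((isUnit_iff_ne_zero.mpr hi).map MvPolynomial.C))
  have h4 : MvPolynomial.X i ∣ π :=
    ((hπ.dvd_irreducible_iff_associated MvPolynomial.X_prime.irreducible).mp h3).symm.dvd
  exact not_X_dvd_diagonalPoly hn d hd i (h4.trans hdvd)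

/-- Eisenstein's criterion in the variable `X 0`, at a simple prime factor of the sum of the other
terms. Among those at least two terms, some exponent is invertible in `k`. -/
theorem prime_diagonalPoly {k : Type u} [Field k] {n : ℕ} (hn : 3 ≤ n) (d : Fin n → ℕ)
    (hd : ∀ i, 1 ≤ d i) (hchar : ∀ i j, (d i : k) = 0 → (d j : k) = 0 → i = j) :
    Prime (diagonalPoly k d) := by
  obtain ⟨n, rfl⟩ : ∃ n', n = n' + 1 := ⟨n - 1, by omega⟩
  rw [← MulEquiv.prime_iff (MvPolynomial.finSuccEquiv k n).toMulEquiv]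
  have hF : (MvPolynomial.finSuccEquiv k n) (diagonalPoly k d) =
      Polynomial.X ^ d 0 + Polynomial.C (diagonalPoly k fun j => d j.succ) := by
    simp [diagonalPoly, Fin.sum_univ_succ, MvPolynomial.finSuccEquiv_X_zero,
      MvPolynomial.finSuccEquiv_X_succ]
  have hd0 : d 0 ≠ 0 := Nat.one_le_iff_ne_zero.mp (hd 0)
  obtain ⟨i, hi⟩ : ∃ i : Fin n, (d i.succ : k) ≠ 0 := by
    by_contra! h
    have := hchar (Fin.succ ⟨0, by omega⟩) (Fin.succ ⟨1, by omega⟩) (h _) (h _)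
    simp at this
  obtain ⟨π, hπ, h1, h2⟩ := exists_prime_dvd_diagonalPoly (k := k) (by omega)
    (fun j => d j.succ) (fun j => hd _) i hi
  change Prime ((MvPolynomial.finSuccEquiv k n) (diagonalPoly k d))
  rw [hF]
  set G := diagonalPoly k fun j => d j.succ
  have hdeg := Polynomial.degree_X_pow_add_C (Nat.pos_of_ne_zero hd0) G
  have hmonic := Polynomial.monic_X_pow_add_C G hd0
  refine Irreducible.prime (Polynomial.irreducible_of_eisenstein_criterion
    (P := Ideal.span {π}) ((Ideal.span_singleton_prime hπ.ne_zero).mpr hπ) ?_ ?_ ?_ ?_ ?_)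
  · rw [hmonic.leadingCoeff, Ideal.mem_span_singleton]
    exact fun h => hπ.not_isUnit (isUnit_of_dvd_one h)
  · intro j hj
    rw [hdeg, Nat.cast_lt] at hj
    rw [Polynomial.coeff_add, Polynomial.coeff_X_pow, if_neg hj.ne, zero_add, Polynomial.coeff_C]
    split_ifs
    · exact Ideal.mem_span_singleton.mpr h1
    · exact zero_mem _
  · rw [hdeg]
    exact_mod_cast Nat.pos_of_ne_zero hd0
  · rw [Ideal.span_singleton_pow, Ideal.mem_span_singleton]
    simpa [Polynomial.coeff_X_pow, hd0.symm] using h2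
  · exact hmonic.isPrimitive

/-! ### Jet ideals and the jets on which they vanish. -/

/-- The jet equations of a hypersurface. -/
theorem jetIdeal_span_singleton {k : Type u} [CommRing k] {σ : Type v} (f : MvPolynomial σ k)
    (m : ℕ) : jetIdeal (Ideal.span {f}) m =
      Ideal.span (Set.range fun j : Fin (m + 1) => (genericJet k σ m f).coeff j) := by
  apply le_antisymm
  · refine Ideal.span_le.mpr ?_
    rintro _ ⟨g, hg, j, hj, rfl⟩
    obtain ⟨h, rfl⟩ := Ideal.mem_span_singleton'.mp hg
    rw [map_mul, Polynomial.coeff_mul]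
    refine sum_mem fun c hc => Ideal.mul_mem_left _ _ (Ideal.subset_span ?_)
    have := Finset.HasAntidiagonal.mem_antidiagonal.mp hc
    exact ⟨⟨c.2, by omega⟩, rfl⟩
  · refine Ideal.span_mono ?_
    rintro _ ⟨j, rfl⟩
    exact ⟨f, Ideal.mem_span_singleton_self f, j, Nat.lt_succ_iff.mp j.2, rfl⟩

/-- The `l`-th coordinate of the jet whose coefficients are given by `φ`. -/
noncomputable def jetCoordinate {k : Type u} [CommRing k] {σ : Type v} {m : ℕ} {A : Type w}
    [CommRing A] (φ : MvPolynomial (σ × Fin (m + 1)) k →+* A) (l : σ) : Polynomial A :=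
  ∑ j : Fin (m + 1), Polynomial.C (φ (MvPolynomial.X (l, j))) * Polynomial.X ^ (j : ℕ)

section

variable {k : Type u} [CommRing k] {σ : Type v} {m : ℕ} {A : Type w}
    [CommRing A] (φ : MvPolynomial (σ × Fin (m + 1)) k →+* A)

theorem coeff_jetCoordinate (l : σ) (j : Fin (m + 1)) :
    (jetCoordinate φ l).coeff j = φ (MvPolynomial.X (l, j)) := by
  simp [jetCoordinate, Polynomial.coeff_X_pow, Fin.val_inj]

theorem coeff_jetCoordinate_of_lt (l : σ) {j : ℕ} (hj : m < j) :
    (jetCoordinate φ l).coeff j = 0 := by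
  simp only [jetCoordinate, Polynomial.finsetSum_coeff, Polynomial.coeff_C_mul,
    Polynomial.coeff_X_pow]
  refine Finset.sum_eq_zero fun i _ => ?_
  rw [if_neg (by have := i.2; omega), mul_zero]

theorem map_genericJet_diagonalPoly {n : ℕ} (d : Fin n → ℕ)
    (φ : MvPolynomial (Fin n × Fin (m + 1)) k →+* A) :
    (genericJet k (Fin n) m (diagonalPoly k d)).map φ = ∑ l, jetCoordinate φ l ^ d l := by
  simp [genericJet, diagonalPoly, jetCoordinate, Polynomial.map_sum]

theorem jetIdeal_diagonalPoly_le_ker_iff {n : ℕ} (d : Fin n → ℕ)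
    (φ : MvPolynomial (Fin n × Fin (m + 1)) k →+* A) :
    jetIdeal (Ideal.span {diagonalPoly k d}) m ≤ RingHom.ker φ ↔
      Polynomial.X ^ (m + 1) ∣ ∑ l, jetCoordinate φ l ^ d l := by
  rw [jetIdeal_span_singleton, Ideal.span_le, Polynomial.X_pow_dvd_iff,
    ← map_genericJet_diagonalPoly, Set.range_subset_iff]
  simp only [Polynomial.coeff_map]
  exact ⟨fun h j hj => h ⟨j, hj⟩, fun h j => h j j.2⟩

end

/-- Krull's height theorem for the jets of a hypersurface. -/
theorem height_le_of_mem_minimalPrimes_jetIdeal {k : Type u} [Field k] {n : ℕ}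
    (f : MvPolynomial (Fin n) k) (m : ℕ) {P : Ideal (MvPolynomial (Fin n × Fin (m + 1)) k)}
    (hP : P ∈ (jetIdeal (Ideal.span {f}) m).minimalPrimes) : P.height ≤ (m + 1 : ℕ) := by
  rw [jetIdeal_span_singleton] at hP
  refine (Ideal.height_le_card_of_mem_minimalPrimes_span (Set.finite_range _) hP).trans ?_
  rw [Nat.cast_le, ← Nat.card_coe_set_eq]
  exact (Finite.card_range_le _).trans (by simp)

/-! ### Codimension in terms of the orders of the generic jet. -/

open Polynomial in
/-- The coefficients of a truncated `d`-th root lie in any subfield which contains the coefficients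
of the radicand and all its own `d`-th roots. -/
theorem Polynomial.coeff_mem_of_X_pow_dvd_pow_add {k L : Type*} [Field k] [Field L] [Algebra k L]
    (E : IntermediateField k L) {u q : L[X]} (hq : q ∈ lifts (algebraMap E L)) {d s : ℕ}
    (hd : (d : L) ≠ 0) (hu : u.coeff 0 ≠ 0) (h : X ^ s ∣ u ^ d + q)
    (hE : ∀ z : L, z ^ d ∈ E → z ∈ E) {j : ℕ} (hj : j < s) : u.coeff j ∈ E := by
  obtain ⟨Q, rfl⟩ := (mem_lifts _).mp hq
  have h0 : u.coeff 0 ^ d + algebraMap E L (Q.coeff 0) = 0 := by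
    have := (X_pow_dvd_iff.mp h) 0 (by omega)
    rwa [coeff_add, coeff_zero_eq_eval_zero, eval_pow, ← coeff_zero_eq_eval_zero, coeff_map] at this
  have hu0 : u.coeff 0 ∈ E := by
    refine hE _ ?_
    rw [eq_neg_of_add_eq_zero_left h0]
    exact neg_mem (Q.coeff 0).2
  -- A root is constructed over `E` by lifting; uniqueness of roots with given constant term then
  -- identifies it with `u` modulo `X ^ s`.
  obtain ⟨v, hv0, hv⟩ := exists_X_pow_dvd_pow_add Q d (⟨u.coeff 0, hu0⟩ : E)
    (Subtype.ext h0) (by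
      refine isUnit_iff_ne_zero.mpr (mul_ne_zero ?_ (pow_ne_zero _ ?_))
      · intro h; exact hd (by simpa using congrArg (algebraMap E L) h)
      · intro h; exact hu (congrArg Subtype.val h)) s
  have h1 : X ^ s ∣ (v.map (algebraMap E L)) ^ d + Q.map (algebraMap E L) := by
    simpa using Polynomial.map_dvd (algebraMap E L) hv
  have hv0' : (v.map (algebraMap E L)).coeff 0 = u.coeff 0 := by
    rw [coeff_map, hv0]; rfl
  have h2 : X ^ s ∣ u - v.map (algebraMap E L) := by
    refine X_pow_dvd_sub_of_X_pow_dvd_pow_sub_pow hv0'.symm (hv0' ▸ hu) hd ?_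
    have := dvd_sub h h1
    rwa [add_sub_add_right_eq_sub] at this
  have h3 := X_pow_dvd_iff.mp h2 j hj
  rw [coeff_sub, coeff_map, sub_eq_zero] at h3
  rw [h3]
  exact (v.coeff j).2

theorem Finset.card_sigma_Ico_add_sum {n m : ℕ} {b : Fin n → ℕ} (hb : ∀ l, b l ≤ m) :
    (Finset.univ.sigma fun l : Fin n => Finset.Ico (b l) m).card + ∑ l, b l = n * m := by
  rw [Finset.card_sigma, ← Finset.sum_add_distrib]
  simp [Nat.sub_add_cancel (hb _)]

/-- If the field `L` is generated by the coefficients of the polynomials `p l` of degree `≤ m`, then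
its transcendence degree is at most the number of coefficients over which all others are
algebraic. -/
theorem trdeg_add_sum_le_of_coeff_mem_algebraicClosure {k L : Type u} [Field k] [Field L]
    [Algebra k L] {n m : ℕ} (p : Fin n → Polynomial L)
    (hgen : ∀ E : IntermediateField k L, (∀ l j, (p l).coeff j ∈ E) → E = ⊤)
    {b : Fin n → ℕ} (hb : ∀ l, b l ≤ m)
    (halg : ∀ E : IntermediateField k L, (∀ z : L, ∀ d ≠ 0, z ^ d ∈ E → z ∈ E) →
      (∀ l j, b l ≤ j → j < m → (p l).coeff j ∈ E) → ∀ l j, (p l).coeff j ∈ E) :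
    Cardinal.toENat (Algebra.trdeg k L) + (∑ l, b l : ℕ) ≤ (n * m : ℕ) := by
  classical
  let I := Finset.univ.sigma fun l : Fin n => Finset.Ico (b l) m
  let T : Finset L := I.image fun x => (p x.1).coeff x.2
  let F := IntermediateField.adjoin k (T : Set L)
  -- Being relatively algebraically closed, `E` contains all roots of its elements, so `halg`
  -- applies.
  let E := (algebraicClosure F L).restrictScalars k
  have hE : E = ⊤ := by
    refine hgen E (halg E ?_ ?_)
    · intro z d hd hz
      have h1 : IsAlgebraic F (z ^ d) := mem_algebraicClosure_iff.mp hz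
      exact mem_algebraicClosure_iff.mpr (h1.of_pow (Nat.pos_of_ne_zero hd))
    · intro l j h1 h2
      have : (p l).coeff j ∈ F := IntermediateField.subset_adjoin _ _
        (Finset.mem_coe.mpr (Finset.mem_image.mpr ⟨⟨l, j⟩, by simp [I, h1, h2], rfl⟩))
      exact mem_algebraicClosure_iff.mpr (isAlgebraic_algebraMap (⟨_, this⟩ : F))
  have halgF : Algebra.IsAlgebraic F L := ⟨fun z => by
    have : z ∈ E := hE ▸ IntermediateField.mem_top
    exact mem_algebraicClosure_iff.mp this⟩
  have halgT : Algebra.IsAlgebraic (Algebra.adjoin k (T : Set L)) L := by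
    open scoped IntermediateField.algebraAdjoinAdjoin in
    exact (IsFractionRing.comap_isAlgebraic_iff (A := Algebra.adjoin k (T : Set L)) (K := F)).mpr
      halgF
  have h1 : Cardinal.toENat (Algebra.trdeg k L) ≤ T.card := by
    have := OrderHomClass.mono Cardinal.toENat
      (Algebra.IsAlgebraic.trdeg_le_cardinalMk k (T : Set L))
    simpa using this
  rw [← Finset.card_sigma_Ico_add_sum hb, Nat.cast_add]
  exact add_le_add_left (h1.trans (Nat.cast_le.mpr Finset.card_image_le)) _

-- The order of `p` capped at `m`; the cap gives a finite value also when `p` vanishes modulo `X ^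
-- m`.
open Polynomial in
theorem Polynomial.exists_truncated_order {L : Type*} [Semiring L] (p : L[X]) (m : ℕ) :
    ∃ a ≤ m, X ^ a ∣ p ∧ (a < m → p.coeff a ≠ 0) ∧ (0 < m → (a = 0 ↔ p.coeff 0 ≠ 0)) := by
  classical
  have hex : ∃ a, a = m ∨ p.coeff a ≠ 0 := ⟨m, Or.inl rfl⟩
  refine ⟨Nat.find hex, Nat.find_min' hex (Or.inl rfl), X_pow_dvd_iff.mpr fun j hj => ?_, ?_, ?_⟩
  · by_contra h
    exact Nat.find_min hex hj (Or.inr h)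
  · exact fun h => (Nat.find_spec hex).resolve_left h.ne
  · intro hm
    rw [Nat.find_eq_zero]
    exact or_iff_right hm.ne

open Polynomial in
/-- The transcendence degree of the field generated by a jet of a diagonal hypersurface, in terms of
the orders `a l` of its coordinates. -/
theorem exists_orders_trdeg_add_sum_le {k L : Type u} [Field k] [Field L]
    [Algebra k L] {n m : ℕ} (hm : 0 < m) (d : Fin n → ℕ) (hd : ∀ i, 1 ≤ d i)
    (hchar : ∀ i j, (d i : k) = 0 → (d j : k) = 0 → i = j) (p : Fin n → L[X])
    (hp : ∀ l j, m ≤ j → (p l).coeff j = 0)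
    (hgen : ∀ E : IntermediateField k L, (∀ l j, (p l).coeff j ∈ E) → E = ⊤)
    (hF : X ^ m ∣ ∑ l, p l ^ d l) :
    ∃ (a : Fin n → ℕ) (e : ℕ), e ≤ m ∧ (∀ l, e ≤ a l * d l) ∧
      (∀ l, a l = 0 ↔ (p l).coeff 0 ≠ 0) ∧
      Cardinal.toENat (Algebra.trdeg k L) + (∑ l, a l + (m - e) : ℕ) ≤ (n * m : ℕ) := by
  choose a ham hdvd hne hzero using fun l => (p l).exists_truncated_order m
  have hd0 : ∀ i, d i ≠ 0 := fun i => Nat.one_le_iff_ne_zero.mp (hd i)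
  have hlow : ∀ l j, j < a l → (p l).coeff j = 0 := fun l j hj => X_pow_dvd_iff.mp (hdvd l) j hj
  by_cases hall : ∀ l, m ≤ a l * d l
  -- The equation holds automatically for these orders, so it imposes no further relation: `e = m`.
  · refine ⟨a, m, le_rfl, hall, fun l => hzero l hm, ?_⟩
    rw [Nat.sub_self, add_zero]
    refine trdeg_add_sum_le_of_coeff_mem_algebraicClosure p hgen ham fun E _ hE l j => ?_
    rcases lt_or_ge j (a l) with h | h
    · rw [hlow l j h]; exact zero_mem _
    rcases lt_or_ge j m with h' | h'
    · exact hE l j h h'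
    · rw [hp l j h']; exact zero_mem _
  push Not at hall
  obtain ⟨l₀, hl₀⟩ := hall
  obtain ⟨i₀, -, hi₀⟩ := Finset.exists_min_image Finset.univ (fun l => a l * d l)
    ⟨l₀, Finset.mem_univ _⟩
  have hmin : ∀ l, a i₀ * d i₀ ≤ a l * d l := fun l => hi₀ l (Finset.mem_univ l)
  have hem : a i₀ * d i₀ < m := (hmin l₀).trans_lt hl₀
  have hpow : ∀ l, X ^ (a l * d l) ∣ p l ^ d l := fun l => by
    rw [pow_mul]; exact pow_dvd_pow_of_dvd (hdvd l) _
  have haim : ∀ i, a i * d i = a i₀ * d i₀ → a i < m := fun i hi =>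
    (Nat.le_mul_of_pos_right _ (hd i)).trans_lt (hi ▸ hem)
  -- Otherwise only `i₀` attains the minimum, by `hchar`; its leading term then has nothing to
  -- cancel against in degree `a i₀ * d i₀ < m`.
  obtain ⟨i, hie, hi⟩ : ∃ i, a i * d i = a i₀ * d i₀ ∧ (d i : k) ≠ 0 := by
    by_contra! hcon
    have h1 := X_pow_dvd_iff.mp hF _ hem
    rw [finsetSum_coeff, Finset.sum_eq_single i₀] at h1
    · obtain ⟨w, hw⟩ := hdvd i₀
      have hw0 : (p i₀).coeff (a i₀) = w.coeff 0 := by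
        rw [hw]; simp [coeff_X_pow_mul']
      rw [hw, mul_pow, ← pow_mul] at h1
      have h2 : (X ^ (a i₀ * d i₀) * w ^ d i₀).coeff (a i₀ * d i₀) = w.coeff 0 ^ d i₀ := by
        rw [coeff_X_pow_mul', if_pos le_rfl, Nat.sub_self, coeff_zero_eq_eval_zero, eval_pow,
          ← coeff_zero_eq_eval_zero]
      rw [h2, ← hw0] at h1
      exact hne i₀ (haim i₀ rfl) (pow_eq_zero_iff (hd0 i₀) |>.mp h1)
    · intro b _ hb
      refine X_pow_dvd_iff.mp (hpow b) _ (lt_of_le_of_ne (hmin b) fun heq => hb ?_)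
      exact hchar _ _ (hcon b heq.symm) (hcon i₀ rfl)
    · simp
  set e := a i₀ * d i₀ with he
  have hai : a i ≤ e := hie ▸ Nat.le_mul_of_pos_right _ (hd i)
  refine ⟨a, e, hem.le, hmin, fun l => hzero l hm, ?_⟩
  -- In the `i`-th coordinate `m - e` further coefficients, starting at the leading one, are dropped
  -- as algebraic over the rest; `a i ≤ e` keeps `b i ≤ m`.
  let b : Fin n → ℕ := fun l => a l + if l = i then m - e else 0
  have hbsum : ∑ l, b l = ∑ l, a l + (m - e) := by
    simp [b, Finset.sum_add_distrib]
  rw [← hbsum]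
  refine trdeg_add_sum_le_of_coeff_mem_algebraicClosure p hgen (b := b) ?_ ?_
  · intro l
    by_cases hl : l = i
    · simp only [b, hl, if_true]; omega
    · simp only [b, if_neg hl]; exact ham l
  intro E hEroot hE
  have hother : ∀ l, l ≠ i → ∀ j, (p l).coeff j ∈ E := by
    intro l hl j
    rcases lt_or_ge j (a l) with h | h
    · rw [hlow l j h]; exact zero_mem _
    rcases lt_or_ge j m with h' | h'
    · exact hE l j (by simpa [b, hl] using h) h'
    · rw [hp l j h']; exact zero_mem _
  have hmid : ∀ j < m - e, (p i).coeff (a i + j) ∈ E := by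
    intro j hj
    obtain ⟨w, hw⟩ := hdvd i
    have hwj : ∀ j, (p i).coeff (a i + j) = w.coeff j := by
      intro j; rw [hw]; simp [coeff_X_pow_mul']
    have hlift : ∑ l ∈ Finset.univ.erase i, p l ^ d l ∈ lifts (algebraMap E L) := by
      refine sum_mem fun l hl => pow_mem ?_ _
      rw [lifts_iff_coeff_lifts]
      exact fun j => ⟨⟨_, hother l (Finset.ne_of_mem_erase hl) j⟩, rfl⟩
    obtain ⟨q, hq⟩ : X ^ e ∣ ∑ l ∈ Finset.univ.erase i, p l ^ d l :=
      Finset.dvd_sum fun l _ => (pow_dvd_pow _ (hmin l)).trans (hpow l)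
    have hqlift : q ∈ lifts (algebraMap E L) := by
      rw [lifts_iff_coeff_lifts] at hlift ⊢
      intro j
      have := hlift (e + j)
      rw [hq] at this
      simpa [coeff_X_pow_mul'] using this
    -- Dividing the equation by `X ^ e` leaves a `d i`-th root problem for `w`, the unit part of `p
    -- i`, modulo `X ^ (m - e)`.
    have hFw : X ^ (m - e) ∣ w ^ d i + q := by
      rw [← Finset.add_sum_erase _ _ (Finset.mem_univ i), hq, hw, mul_pow, ← pow_mul, hie,
        ← mul_add] at hF
      have hme : m = e + (m - e) := by omega
      rw [hme, pow_add] at hF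
      have := (mul_dvd_mul_iff_left (pow_ne_zero e X_ne_zero)).mp hF
      exact this
    rw [hwj]
    refine Polynomial.coeff_mem_of_X_pow_dvd_pow_add E hqlift ?_ ?_ hFw
      (fun z hz => hEroot z _ (hd0 i) hz) hj
    · intro h
      exact hi ((algebraMap k L).injective (by simpa using h))
    · rw [← hwj, add_zero]; exact hne i (haim i hie)
  intro l j
  by_cases hl : l = i
  · subst hl
    rcases lt_or_ge j (a l) with h | h
    · rw [hlow l j h]; exact zero_mem _
    rcases lt_or_ge j (b l) with h' | h'
    · have h2 : j < a l + (m - e) := by simpa [b] using h'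
      have := hmid (j - a l) (by omega)
      rwa [Nat.add_sub_cancel' h] at this
    rcases lt_or_ge j m with h2 | h2
    · exact hE l j h' h2
    · rw [hp l j h2]; exact zero_mem _
  · exact hother l hl j

/-- The evaluation of a polynomial ring in the fraction field of a residue ring. -/
noncomputable def toResidueField {R : Type u} [CommRing R] (P : Ideal R) [P.IsPrime] :
    R →+* FractionRing (R ⧸ P) :=
  (algebraMap (R ⧸ P) (FractionRing (R ⧸ P))).comp (Ideal.Quotient.mk P)

theorem toResidueField_eq_zero_iff {R : Type u} [CommRing R] (P : Ideal R) [P.IsPrime] (x : R) :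
    toResidueField P x = 0 ↔ x ∈ P := by
  rw [toResidueField, RingHom.comp_apply,
    map_eq_zero_iff _ (IsFractionRing.injective (R ⧸ P) (FractionRing (R ⧸ P))),
    Ideal.Quotient.eq_zero_iff_mem]

theorem ker_toResidueField {R : Type u} [CommRing R] (P : Ideal R) [P.IsPrime] :
    RingHom.ker (toResidueField P) = P :=
  Ideal.ext fun x => (RingHom.mem_ker).trans (toResidueField_eq_zero_iff P x)

/-- A lower bound for the height of a prime containing the jet ideal of a diagonal hypersurface, in
terms of the orders `a l` of the coordinates of its generic jet. -/
theorem exists_orders_sum_add_le_height {k : Type u} [Field k] {n m : ℕ} (d : Fin n → ℕ)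
    (hd : ∀ i, 1 ≤ d i) (hchar : ∀ i j, (d i : k) = 0 → (d j : k) = 0 → i = j)
    (P : Ideal (MvPolynomial (Fin n × Fin (m + 1)) k)) [P.IsPrime]
    (hP : jetIdeal (Ideal.span {diagonalPoly k d}) m ≤ P) :
    ∃ (a : Fin n → ℕ) (e : ℕ), e ≤ m + 1 ∧ (∀ l, e ≤ a l * d l) ∧
      (∀ l, a l = 0 ↔ MvPolynomial.X (l, 0) ∉ P) ∧
      ((∑ l, a l + (m + 1 - e) : ℕ) : ℕ∞) ≤ P.height := by
  let ψ := toResidueField P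
  have hF := (jetIdeal_diagonalPoly_le_ker_iff d ψ).mp (hP.trans (ker_toResidueField P).ge)
  obtain ⟨a, e, h1, h2, h3, h4⟩ := exists_orders_trdeg_add_sum_le (k := k) (m := m + 1)
    m.succ_pos d hd hchar (jetCoordinate ψ)
    (fun l j hj => coeff_jetCoordinate_of_lt ψ l hj) (by
      intro E hE
      have hmem : ∀ f, ψ f ∈ E := by
        intro f
        induction f using MvPolynomial.induction_on with
        | C c => exact E.algebraMap_mem c
        | add f g hf hg => rw [map_add]; exact add_mem hf hg
        | mul_X f x hf =>
          rw [map_mul]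
          exact mul_mem hf (coeff_jetCoordinate ψ x.1 x.2 ▸ hE x.1 x.2)
      refine eq_top_iff.mpr fun z _ => ?_
      obtain ⟨x, y, -, rfl⟩ := IsFractionRing.div_surjective (A := _ ⧸ P) z
      obtain ⟨x, rfl⟩ := Ideal.Quotient.mk_surjective x
      obtain ⟨y, rfl⟩ := Ideal.Quotient.mk_surjective y
      exact div_mem (hmem x) (hmem y)) hF
  refine ⟨a, e, h1, h2, fun l => ?_, ?_⟩
  · rw [h3, Ne, not_iff_not]
    exact (coeff_jetCoordinate ψ l 0 ▸ toResidueField_eq_zero_iff P _)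
  · have h5 := MvPolynomial.card_le_height_add_trdeg P
    have h6 : Algebra.trdeg k (MvPolynomial (Fin n × Fin (m + 1)) k ⧸ P) ≤
        Algebra.trdeg k (FractionRing (MvPolynomial (Fin n × Fin (m + 1)) k ⧸ P)) :=
      trdeg_le_of_injective (IsScalarTower.toAlgHom k _ _) (IsFractionRing.injective _ _)
    have h7 := h5.trans (add_le_add_right (OrderHomClass.mono Cardinal.toENat h6) _)
    rw [Fintype.card_prod, Fintype.card_fin, Fintype.card_fin] at h7
    have h8 := h4.trans h7
    rw [add_comm P.height] at h8
    -- Cancellation needs a finite transcendence degree, which `h4` provides.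
    refine (ENat.add_le_add_iff_left ?_).mp h8
    intro htop
    rw [htop, top_add] at h4
    exact ENat.natCast_ne_top _ (top_le_iff.mp h4)

/-! ### Irreducibility of the locus where a coordinate is invertible. -/

/-- Two nonzero coordinates suffice: `1` at `i` and a `d j`-th root of `-1` at some `j ≠ i`. -/
theorem exists_diagonalPoly_root {k : Type u} [Field k] [IsAlgClosed k] {n : ℕ}
    (hn : 2 ≤ n) (d : Fin n → ℕ) (hd : ∀ i, 1 ≤ d i) (i : Fin n) :
    ∃ x : Fin n → k, ∑ l, x l ^ d l = 0 ∧ x i ≠ 0 := by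
  have hd0 : ∀ i, d i ≠ 0 := fun i => Nat.one_le_iff_ne_zero.mp (hd i)
  have : Nontrivial (Fin n) := Fin.nontrivial_iff_two_le.mpr hn
  obtain ⟨j, hj⟩ := exists_ne i
  obtain ⟨z, hz⟩ := IsAlgClosed.exists_pow_nat_eq (-1 : k) (hd j)
  refine ⟨Pi.single i 1 + Pi.single j z, ?_, by simp [hj.symm]⟩
  rw [← Finset.add_sum_erase _ _ (Finset.mem_univ i), ← Finset.add_sum_erase _ _
    (Finset.mem_erase.mpr ⟨hj, Finset.mem_univ j⟩), Finset.sum_eq_zero]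
  · simp [hj, hj.symm, hz]
  · intro l hl
    simp only [Finset.mem_erase] at hl
    simp [hl.1, hl.2.1, hd0]

open Polynomial in
/-- A tuple of power series solving a diagonal equation at the origin can be corrected in its `i`-th
coordinate to a solution modulo `X ^ s`. -/
theorem Polynomial.exists_update_X_pow_dvd_sum_pow {B : Type*} [CommRing B] {n : ℕ}
    (d : Fin n → ℕ) (i : Fin n) (hi : IsUnit (d i : B)) (y : Fin n → B[X])
    (hy : ∑ l, (y l).coeff 0 ^ d l = 0) (hyi : IsUnit ((y i).coeff 0)) (s : ℕ) :
    ∃ v : B[X], v.coeff 0 = (y i).coeff 0 ∧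
      X ^ s ∣ ∑ l, Function.update y i v l ^ d l := by
  obtain ⟨v, hv0, hv⟩ := exists_X_pow_dvd_pow_add
    (∑ l ∈ Finset.univ.erase i, y l ^ d l) (d i) ((y i).coeff 0) (by
      rw [← Finset.add_sum_erase _ _ (Finset.mem_univ i)] at hy
      rw [finsetSum_coeff]
      simpa only [coeff_zero_eq_eval_zero, eval_pow] using hy) (hi.mul (hyi.pow _)) s
  refine ⟨v, hv0, ?_⟩
  rw [← Finset.add_sum_erase _ _ (Finset.mem_univ i), Function.update_self]
  convert! hv using 2
  exact Finset.sum_congr rfl fun l hl => by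
    rw [Function.update_of_ne (Finset.ne_of_mem_erase hl)]

open Polynomial in
/-- Two truncated solutions of a diagonal equation which agree away from the `i`-th coordinate and
at the origin agree. -/
theorem Polynomial.X_pow_dvd_sub_of_X_pow_dvd_sum_pow {L : Type*} [CommRing L] [IsDomain L] {n : ℕ}
    (d : Fin n → ℕ) (i : Fin n) (hi : (d i : L) ≠ 0) (p q : Fin n → L[X]) {s : ℕ}
    (hp : X ^ s ∣ ∑ l, p l ^ d l) (hq : X ^ s ∣ ∑ l, q l ^ d l) (hpq : ∀ l, l ≠ i → p l = q l)
    (h0 : (p i).coeff 0 = (q i).coeff 0) (hqi : (q i).coeff 0 ≠ 0) (l : Fin n) :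
    X ^ s ∣ p l - q l := by
  by_cases hl : l = i
  · subst hl
    refine X_pow_dvd_sub_of_X_pow_dvd_pow_sub_pow (d := d l) h0 hqi hi ?_
    have h2 := dvd_sub hp hq
    rw [← Finset.sum_sub_distrib, Finset.sum_eq_single l] at h2
    · exact h2
    · intro b _ hb
      rw [hpq b hb, sub_self]
    · simp
  · rw [hpq l hl, sub_self]
    exact dvd_zero _

open Polynomial in
/-- The universal jet on a diagonal hypersurface over the locus where the `i`-th coordinate is
invertible. -/
theorem exists_universal_diagonal_jet {D₀ : Type u} [CommRing D₀] [IsDomain D₀] {n : ℕ}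
    (d : Fin n → ℕ) (x : Fin n → D₀) (hx : ∑ l, x l ^ d l = 0) (i : Fin n) (hxi : x i ≠ 0)
    (hi : IsUnit (d i : D₀)) (m : ℕ) :
    ∃ (B : Type u) (_ : CommRing B) (_ : IsDomain B) (ι : D₀ →+* B) (p : Fin n → B[X]),
      X ^ (m + 1) ∣ ∑ l, p l ^ d l ∧
      ∀ (L : Type u) [Field L] (g₀ : D₀ →+* L) (q : Fin n → L[X]),
        (∀ l, (q l).coeff 0 = g₀ (x l)) → g₀ (x i) ≠ 0 → (∀ l j, m < j → (q l).coeff j = 0) →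
        X ^ (m + 1) ∣ ∑ l, q l ^ d l →
        ∃ g : B →+* L, g.comp ι = g₀ ∧ ∀ l, X ^ (m + 1) ∣ (p l).map g - q l := by
  let D := MvPolynomial (Fin n × ℕ) D₀
  let c : D₀ →+* D := MvPolynomial.C
  have hc : c (x i) ≠ 0 := by
    rwa [Ne, map_eq_zero_iff _ (MvPolynomial.C_injective _ D₀)]
  let B := Localization.Away (c (x i))
  have hB : IsDomain B := IsLocalization.isDomain_localization
    (powers_le_nonZeroDivisors_of_noZeroDivisors hc)
  let τ : D →+* B := algebraMap D B
  let ι : D₀ →+* B := τ.comp c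
  -- The variable `(l, j)` is the coefficient of index `j + 1`, the constant terms being those of
  -- `x`. Only `j < m` occurs, and the `i`-th series is later replaced by the lifted root.
  let y : Fin n → B[X] := fun l => C (ι (x l)) +
    X * ∑ j ∈ Finset.range m, C (τ (MvPolynomial.X (l, j))) * X ^ j
  have hy0 : ∀ l, (y l).coeff 0 = ι (x l) := fun l => by simp [y]
  obtain ⟨v, hv0, hv⟩ := Polynomial.exists_update_X_pow_dvd_sum_pow d i
    (by simpa using hi.map ι) y (by simpa [hy0] using congrArg ι hx)
    (by rw [hy0]; exact IsLocalization.Away.algebraMap_isUnit (c (x i))) (m + 1)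
  refine ⟨B, inferInstance, hB, ι, Function.update y i v, hv, ?_⟩
  intro L _ g₀ q hq0 hxi' hqm hq
  let g₁ : D →+* L := MvPolynomial.eval₂Hom g₀ fun z => (q z.1).coeff (z.2 + 1)
  have hg₁ : ∀ z, g₁ (c z) = g₀ z := fun z => MvPolynomial.eval₂Hom_C _ _ z
  let g : B →+* L := IsLocalization.Away.lift (c (x i)) (g := g₁) (by
    rw [hg₁]; exact isUnit_iff_ne_zero.mpr hxi')
  have hg : ∀ z, g (τ z) = g₁ z := fun z => IsLocalization.Away.lift_eq _ _ z
  have hgι : ∀ z, g (ι z) = g₀ z := fun z => (hg _).trans (hg₁ z)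
  refine ⟨g, RingHom.ext hgι, ?_⟩
  have hgy : ∀ l, (y l).map g = q l := by
    intro l
    ext j
    rcases j with _ | j
    · rw [coeff_map, hy0, hgι, hq0]
    · have h1 : (y l).coeff (j + 1) = if j < m then τ (MvPolynomial.X (l, j)) else 0 := by
        simp only [y, coeff_add, coeff_C_succ, zero_add, coeff_X_mul, finsetSum_coeff,
          coeff_C_mul_X_pow]
        simp
      rw [coeff_map, h1]
      split_ifs with h
      · rw [hg]; exact MvPolynomial.eval₂Hom_X' _ _ _
      · rw [map_zero, hqm]; omega
  refine Polynomial.X_pow_dvd_sub_of_X_pow_dvd_sum_pow d i ?_ _ q ?_ hq ?_ ?_ ?_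
  · simpa using ((hi.map g₀).ne_zero)
  · simpa [Polynomial.map_sum] using Polynomial.map_dvd g hv
  · intro l hl
    rw [Function.update_of_ne hl, hgy]
  · rw [Function.update_self, coeff_map, hv0, hy0, hgι, hq0]
  · rw [hq0]; exact hxi'

theorem mk_X_ne_zero_of_diagonalPoly {k : Type u} [Field k] [IsAlgClosed k] {n : ℕ}
    (hn : 2 ≤ n) (d : Fin n → ℕ) (hd : ∀ i, 1 ≤ d i) (i : Fin n) :
    Ideal.Quotient.mk (Ideal.span {diagonalPoly k d}) (MvPolynomial.X i) ≠ 0 := by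
  intro h
  obtain ⟨g, hg⟩ := Ideal.mem_span_singleton.mp (Ideal.Quotient.eq_zero_iff_mem.mp h)
  obtain ⟨x, hx, hxi⟩ := exists_diagonalPoly_root (k := k) hn d hd i
  have h2 := congrArg (MvPolynomial.eval x) hg
  rw [map_mul, diagonalPoly_eval, hx, zero_mul, MvPolynomial.eval_X] at h2
  exact hxi h2

open Polynomial in
/-- The jets whose `i`-th coordinate does not vanish at the origin form an irreducible set when
`d i` is invertible. -/
theorem exists_prime_le_of_X_notMem {k : Type u} [Field k] [IsAlgClosed k] {n : ℕ} (hn : 3 ≤ n)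
    (d : Fin n → ℕ) (hd : ∀ i, 1 ≤ d i)
    (hchar : ∀ i j, (d i : k) = 0 → (d j : k) = 0 → i = j) (m : ℕ) (i : Fin n)
    (hi : (d i : k) ≠ 0) :
    ∃ P₀ : Ideal (MvPolynomial (Fin n × Fin (m + 1)) k), P₀.IsPrime ∧
      jetIdeal (Ideal.span {diagonalPoly k d}) m ≤ P₀ ∧
      ∀ P : Ideal (MvPolynomial (Fin n × Fin (m + 1)) k), P.IsPrime →
        jetIdeal (Ideal.span {diagonalPoly k d}) m ≤ P → MvPolynomial.X (i, 0) ∉ P → P₀ ≤ P := by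
  have hF : Prime (diagonalPoly k d) := prime_diagonalPoly hn d hd hchar
  have hIF : (Ideal.span {diagonalPoly k d}).IsPrime :=
    (Ideal.span_singleton_prime hF.ne_zero).mpr hF
  let π := Ideal.Quotient.mk (Ideal.span {diagonalPoly k d})
  have hπF : ∑ l, π (MvPolynomial.X l) ^ d l = 0 := by
    have h1 : π (diagonalPoly k d) = 0 :=
      Ideal.Quotient.eq_zero_iff_mem.mpr (Ideal.mem_span_singleton_self _)
    calc ∑ l, π (MvPolynomial.X l) ^ d l = π (∑ l, MvPolynomial.X l ^ d l) := by
          simp only [map_sum, map_pow]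
      _ = 0 := h1
  obtain ⟨B, _, _, ι, p, hpF, huniv⟩ := exists_universal_diagonal_jet d
    (fun l => π (MvPolynomial.X l)) hπF i (mk_X_ne_zero_of_diagonalPoly (by omega) d hd i)
    (by simpa using (isUnit_iff_ne_zero.mpr hi).map (π.comp MvPolynomial.C)) m
  let Φ : MvPolynomial (Fin n × Fin (m + 1)) k →+* B :=
    MvPolynomial.eval₂Hom ((ι.comp π).comp MvPolynomial.C) fun x => (p x.1).coeff x.2
  have hΦX : ∀ l j, Φ (MvPolynomial.X (l, j)) = (p l).coeff j :=
    fun l j => MvPolynomial.eval₂Hom_X' _ _ _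
  -- The lifted coordinate of `p` may have degree above `m`, so the two agree only after truncation.
  have hΦ : ∀ l, X ^ (m + 1) ∣ jetCoordinate Φ l - p l := by
    intro l
    rw [X_pow_dvd_iff]
    intro j hj
    rw [coeff_sub, coeff_jetCoordinate _ l ⟨j, hj⟩, hΦX, sub_self]
  refine ⟨RingHom.ker Φ, RingHom.ker_isPrime _, ?_, ?_⟩
  · rw [jetIdeal_diagonalPoly_le_ker_iff]
    have h1 : X ^ (m + 1) ∣ ∑ l, jetCoordinate Φ l ^ d l - ∑ l, p l ^ d l := by
      rw [← Finset.sum_sub_distrib]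
      exact Finset.dvd_sum fun l _ => (hΦ l).trans (sub_dvd_pow_sub_pow _ _ _)
    exact (dvd_iff_dvd_of_dvd_sub h1).mpr hpF
  intro P hP hJ hXi
  let ψ := toResidueField P
  have hψF := (jetIdeal_diagonalPoly_le_ker_iff d ψ).mp (hJ.trans (ker_toResidueField P).ge)
  have hψ0 : ∑ l, ψ (MvPolynomial.X (l, 0)) ^ d l = 0 := by
    have h1 := X_pow_dvd_iff.mp hψF 0 m.succ_pos
    rw [finsetSum_coeff] at h1
    rw [← h1]
    refine Finset.sum_congr rfl fun l _ => ?_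
    rw [coeff_zero_eq_eval_zero, eval_pow, ← coeff_zero_eq_eval_zero]
    exact congrArg (· ^ d l) (coeff_jetCoordinate ψ l 0).symm
  let h₀ := MvPolynomial.eval₂Hom (ψ.comp MvPolynomial.C) fun l => ψ (MvPolynomial.X (l, 0))
  have hh₀ : ∀ l, h₀ (MvPolynomial.X l) = ψ (MvPolynomial.X (l, 0)) :=
    fun l => MvPolynomial.eval₂Hom_X' _ _ _
  have hker : Ideal.span {diagonalPoly k d} ≤ RingHom.ker h₀ := by
    rw [Ideal.span_singleton_le_iff_mem, RingHom.mem_ker, diagonalPoly, map_sum, ← hψ0]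
    exact Finset.sum_congr rfl fun l _ => by rw [map_pow, hh₀]
  let g₀ := Ideal.Quotient.lift _ h₀ hker
  have hg₀ : ∀ f, g₀ (π f) = h₀ f := fun f => Ideal.Quotient.lift_mk _ _ _
  obtain ⟨g, hgι, hg⟩ := huniv _ g₀ (jetCoordinate ψ)
    (fun l => by rw [hg₀, hh₀]; exact coeff_jetCoordinate ψ l 0)
    (by rw [hg₀, hh₀, Ne, toResidueField_eq_zero_iff]; exact hXi)
    (fun l j hj => coeff_jetCoordinate_of_lt ψ l hj) hψF
  -- The generic jet of `P` is a specialization of the universal one, so `ker Φ ≤ ker ψ = P`.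
  have hcomp : g.comp Φ = ψ := by
    refine MvPolynomial.ringHom_ext ?_ ?_
    · intro c
      have h1 : Φ (MvPolynomial.C c) = ι (π (MvPolynomial.C c)) := MvPolynomial.eval₂Hom_C _ _ _
      rw [RingHom.comp_apply, h1, ← RingHom.comp_apply, hgι, hg₀]
      exact MvPolynomial.eval₂Hom_C _ _ _
    · rintro ⟨l, j⟩
      have h1 := X_pow_dvd_iff.mp (hg l) j j.2
      rw [coeff_sub, coeff_map, coeff_jetCoordinate, sub_eq_zero] at h1
      rw [← h1, RingHom.comp_apply, hΦX]
  intro f hf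
  rw [← toResidueField_eq_zero_iff]
  change ψ f = 0
  rw [← hcomp, RingHom.comp_apply, RingHom.mem_ker.mp hf, map_zero]

/-! ### Irreducibility when the sum exceeds one. -/

theorem isPrime_nilradical_quotient_iff {R : Type u} [CommRing R] (J : Ideal R) :
    (nilradical (R ⧸ J)).IsPrime ↔ J.radical.IsPrime := by
  have h : J.radical = (nilradical (R ⧸ J)).comap (Ideal.Quotient.mk J) := by
    rw [nilradical, Ideal.comap_radical, Ideal.zero_eq_bot, ← RingHom.ker_eq_comap_bot,
      Ideal.mk_ker]
  rw [h]
  refine ⟨fun _ => Ideal.comap_isPrime _ _, fun hp => ?_⟩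
  rw [← Ideal.map_comap_of_surjective _ (Ideal.Quotient.mk_surjective (I := J)) (nilradical _)]
  refine Ideal.map_isPrime_of_surjective Ideal.Quotient.mk_surjective ?_
  rw [Ideal.mk_ker, ← h]
  exact Ideal.le_radical

theorem irreducibleSpace_jetScheme_iff {k : Type u} [CommRing k] {σ : Type v}
    (I : Ideal (MvPolynomial σ k)) (m : ℕ) :
    IrreducibleSpace (jetScheme I m) ↔ (jetIdeal I m).radical.IsPrime :=
  PrimeSpectrum.irreducibleSpace_iff_isPrime_nilradical.trans (isPrime_nilradical_quotient_iff _)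

/-- The ideal is the kernel of the endomorphism that kills the variables in `s` and fixes the
others. -/
theorem MvPolynomial.isPrime_span_X_image {k : Type u} [CommRing k] [IsDomain k] {σ : Type v}
    (s : Set σ) : (Ideal.span (MvPolynomial.X '' s : Set (MvPolynomial σ k))).IsPrime := by
  classical
  let φ : MvPolynomial σ k →ₐ[k] MvPolynomial σ k :=
    MvPolynomial.aeval fun i => if i ∈ s then 0 else MvPolynomial.X i
  let I : Ideal (MvPolynomial σ k) := Ideal.span (MvPolynomial.X '' s)
  have hφ : ((Ideal.Quotient.mkₐ k I).comp φ) = Ideal.Quotient.mkₐ k I := by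
    refine MvPolynomial.algHom_ext fun i => ?_
    by_cases hi : i ∈ s
    · have : Ideal.Quotient.mk I (MvPolynomial.X i) = 0 :=
        Ideal.Quotient.eq_zero_iff_mem.mpr (Ideal.subset_span (Set.mem_image_of_mem _ hi))
      simp [φ, hi, this]
    · simp [φ, hi]
  have h : I = RingHom.ker φ := by
    apply le_antisymm
    · refine Ideal.span_le.mpr ?_
      rintro _ ⟨i, hi, rfl⟩
      simp [φ, hi]
    · intro f hf
      have := DFunLike.congr_fun hφ f
      rw [AlgHom.comp_apply, RingHom.mem_ker.mp hf, map_zero] at this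
      exact Ideal.Quotient.eq_zero_iff_mem.mp this.symm
  change I.IsPrime
  rw [h]
  exact RingHom.ker_isPrime _

theorem isPrime_radical_jetIdeal_of_one_lt {k : Type u} [Field k] [IsAlgClosed k] {n : ℕ}
    (hn : 3 ≤ n) (d : Fin n → ℕ) (hd : ∀ i, 1 ≤ d i)
    (hchar : ∀ i j, (d i : k) = 0 → (d j : k) = 0 → i = j)
    (hsum : 1 < ∑ i, (1 : ℝ) / (d i : ℝ)) (m : ℕ) :
    (jetIdeal (Ideal.span {diagonalPoly k d}) m).radical.IsPrime := by
  obtain ⟨i, hi⟩ : ∃ i : Fin n, (d i : k) ≠ 0 := by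
    by_contra! h
    have := hchar ⟨0, by omega⟩ ⟨1, by omega⟩ (h _) (h _)
    simp at this
  obtain ⟨P₀, hP₀, hJ, hle⟩ := exists_prime_le_of_X_notMem hn d hd hchar m i hi
  suffices h : (jetIdeal (Ideal.span {diagonalPoly k d}) m).radical = P₀ by rwa [h]
  refine le_antisymm (hP₀.radical_le_iff.mpr hJ) ?_
  rw [← Ideal.sInf_minimalPrimes]
  -- It suffices that every minimal prime avoids `X (i, 0)`, for then `P₀` lies in all of them.
  refine le_sInf fun P hP => ?_
  have hPp : P.IsPrime := hP.1.1
  refine hle P hPp hP.1.2 ?_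
  obtain ⟨a, e, hem, he, ha, hht⟩ := exists_orders_sum_add_le_height d hd hchar P hP.1.2
  have h1 : ∑ l, a l + (m + 1 - e) ≤ m + 1 :=
    Nat.cast_le.mp (hht.trans (height_le_of_mem_minimalPrimes_jetIdeal _ m hP))
  have h2 : (∑ l, (a l : ℝ)) ≤ e := by
    rw [← Nat.cast_sum]
    exact_mod_cast (by omega : ∑ l, a l ≤ e)
  have h3 : (e : ℝ) * ∑ l, (1 : ℝ) / (d l : ℝ) ≤ ∑ l, (a l : ℝ) := by
    rw [Finset.mul_sum]
    refine Finset.sum_le_sum fun l _ => ?_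
    rw [mul_one_div, div_le_iff₀ (by exact_mod_cast hd l)]
    exact_mod_cast he l
  -- Together `h2` and `h3` give `e * ∑ 1 / d l ≤ e`, with a sum larger than one.
  have h4 : e = 0 := by
    by_contra h
    have : (0 : ℝ) < e := by exact_mod_cast Nat.pos_of_ne_zero h
    nlinarith
  have h5 : a i ≤ ∑ l, a l := Finset.single_le_sum (fun _ _ => Nat.zero_le _) (Finset.mem_univ i)
  exact (ha i).mp (by omega)

/-! ### Reducibility when the sum is at most one. -/

/-- Witnessed by a constant jet at a point of the hypersurface whose `i`-th coordinate is nonzero.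
-/
theorem X_notMem_radical_jetIdeal {k : Type u} [Field k] [IsAlgClosed k] {n : ℕ}
    (hn : 2 ≤ n) (d : Fin n → ℕ) (hd : ∀ i, 1 ≤ d i) (m : ℕ) (i : Fin n) :
    MvPolynomial.X (i, 0) ∉ (jetIdeal (Ideal.span {diagonalPoly k d}) m).radical := by
  obtain ⟨x, hx, hxi⟩ := exists_diagonalPoly_root (k := k) hn d hd i
  let φ := MvPolynomial.eval fun z : Fin n × Fin (m + 1) => if z.2 = 0 then x z.1 else 0
  have hφ : jetIdeal (Ideal.span {diagonalPoly k d}) m ≤ RingHom.ker φ := by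
    rw [jetIdeal_diagonalPoly_le_ker_iff]
    have h : ∀ l, jetCoordinate φ l = Polynomial.C (x l) := fun l => by
      simp [jetCoordinate, φ, Fin.sum_univ_succ]
    simp only [h, ← map_pow, ← map_sum, hx, map_zero, dvd_zero]
  intro h
  have h1 := (RingHom.ker_isPrime φ).radical_le_iff.mpr hφ h
  rw [RingHom.mem_ker] at h1
  exact hxi (by simpa [φ] using h1)

/-- The jets whose coordinates have orders at least `c l` lie on the diagonal hypersurface if
`c l * d l > m` for all `l`. -/
theorem jetIdeal_le_span_X {k : Type u} [Field k] {n m : ℕ} (d c : Fin n → ℕ)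
    (hc : ∀ l, m + 1 ≤ c l * d l) :
    jetIdeal (Ideal.span {diagonalPoly k d}) m ≤
      Ideal.span (MvPolynomial.X '' {z : Fin n × Fin (m + 1) | (z.2 : ℕ) < c z.1}) := by
  refine le_trans ?_ (Ideal.mk_ker (I := Ideal.span
    (MvPolynomial.X '' {z : Fin n × Fin (m + 1) | (z.2 : ℕ) < c z.1}))).le
  rw [jetIdeal_diagonalPoly_le_ker_iff]
  refine Finset.dvd_sum fun l _ => (pow_dvd_pow _ (hc l)).trans ?_
  rw [pow_mul]
  refine pow_dvd_pow_of_dvd (Finset.dvd_sum fun j _ => ?_) _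
  rcases lt_or_ge (j : ℕ) (c l) with h | h
  · have hmem : (l, j) ∈ {z : Fin n × Fin (m + 1) | (z.2 : ℕ) < c z.1} := h
    rw [Ideal.Quotient.eq_zero_iff_mem.mpr (Ideal.subset_span (Set.mem_image_of_mem _ hmem)),
      map_zero, zero_mul]
    exact dvd_zero _
  · exact (pow_dvd_pow _ h).mul_left _

/-- The linear space `V(Q)` is too large to be a proper closed subset of an irreducible jet scheme
whose codimension is at least `m + 1`. -/
theorem not_isPrime_radical_jetIdeal {k : Type u} [Field k] [IsAlgClosed k] {n m : ℕ}
    (hn : 2 ≤ n) (d : Fin n → ℕ) (hd : ∀ i, 1 ≤ d i)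
    (hchar : ∀ i j, (d i : k) = 0 → (d j : k) = 0 → i = j) (c : Fin n → ℕ)
    (hc : ∀ l, m + 1 ≤ c l * d l) (hcsum : ∑ l, c l ≤ m + 1) :
    ¬ (jetIdeal (Ideal.span {diagonalPoly k d}) m).radical.IsPrime := by
  classical
  intro hP
  let S := Finset.univ.filter fun z : Fin n × Fin (m + 1) => (z.2 : ℕ) < c z.1
  let T : Finset (MvPolynomial (Fin n × Fin (m + 1)) k) := S.image MvPolynomial.X
  have hT : (T : Set (MvPolynomial (Fin n × Fin (m + 1)) k)) =
      MvPolynomial.X '' {z : Fin n × Fin (m + 1) | (z.2 : ℕ) < c z.1} := by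
    simp [T, S]
  have hcard : T.card ≤ m + 1 := by
    refine Finset.card_image_le.trans (le_trans ?_ hcsum)
    simp only [S]
    rw [← Finset.univ_product_univ, Finset.card_filter, Finset.sum_product]
    refine Finset.sum_le_sum fun l _ => ?_
    rw [← Finset.card_filter]
    calc _ = ((Finset.univ.filter fun j : Fin (m + 1) => (j : ℕ) < c l).image
          (Fin.val : Fin (m + 1) → ℕ)).card :=
            (Finset.card_image_of_injective _ Fin.val_injective).symm
      _ ≤ (Finset.range (c l)).card := Finset.card_le_card fun j hj => by
            obtain ⟨j', hj', rfl⟩ := Finset.mem_image.mp hj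
            exact Finset.mem_range.mpr (Finset.mem_filter.mp hj').2
      _ = c l := Finset.card_range _
  let Q := Ideal.span (T : Set (MvPolynomial (Fin n × Fin (m + 1)) k))
  have hQ : Q.IsPrime := by
    simp only [Q, hT]
    exact MvPolynomial.isPrime_span_X_image _
  have hQht : Q.height ≤ (m + 1 : ℕ) :=
    (Ideal.height_le_card_of_mem_minimalPrimes_span_finset (s := T)
      ⟨⟨hQ, le_rfl⟩, fun _ h _ => h.2⟩).trans (Nat.cast_le.mpr hcard)
  set P := (jetIdeal (Ideal.span {diagonalPoly k d}) m).radical with hPdef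
  have hPQ : P ≤ Q := by
    refine hQ.radical_le_iff.mpr ((jetIdeal_le_span_X d c hc).trans_eq ?_)
    simp only [Q, hT]
  have i : Fin n := ⟨0, by omega⟩
  have hXP : MvPolynomial.X (i, 0) ∉ P := X_notMem_radical_jetIdeal hn d hd m i
  have hXQ : MvPolynomial.X (i, 0) ∈ Q := by
    refine Ideal.subset_span (hT ▸ Set.mem_image_of_mem _ ?_)
    have := hc i
    exact Nat.pos_of_ne_zero fun h => by simp [h] at this
  have hlt : P < Q := lt_of_le_of_ne hPQ fun h => hXP (h ▸ hXQ)
  obtain ⟨a, e, -, he, ha, hht⟩ := exists_orders_sum_add_le_height d hd hchar P Ideal.le_radical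
  have he0 : e = 0 := by
    have := he i
    rw [(ha i).mpr hXP] at this
    omega
  -- With `e = 0` the height of `P` is at least `m + 1`, while `P < Q` forces it below the height of
  -- `Q`, which is at most `m + 1`.
  have h1 := (add_le_add_left hht 1).trans
    ((Ideal.height_add_one_le_of_lt_of_isPrime hlt).trans hQht)
  have h2 : ∑ l, a l + (m + 1 - e) + 1 ≤ m + 1 := by exact_mod_cast h1
  omega

theorem mainTheorem11 {k : Type u} [Field k] [IsAlgClosed k] {n : ℕ} (hn : 3 ≤ n)
    (d : Fin n → ℕ) (hd : ∀ i, 1 ≤ d i)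
    (hchar : ∀ i j, ringChar k ∣ d i → ringChar k ∣ d j → i = j) :
    (∀ m : ℕ, 1 ≤ m → IrreducibleSpace (jetScheme (Ideal.span {diagonalPoly k d}) m)) ↔
      1 < ∑ i, (1 : ℝ) / (d i : ℝ) := by
  have hchar' : ∀ i j, (d i : k) = 0 → (d j : k) = 0 → i = j := fun i j hi hj =>
    hchar i j ((ringChar.spec k _).mp hi) ((ringChar.spec k _).mp hj)
  simp only [irreducibleSpace_jetScheme_iff]
  refine ⟨fun h => ?_, fun h m _ => isPrime_radical_jetIdeal_of_one_lt hn d hd hchar' h m⟩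
  by_contra! hsum
  have hdpos : ∀ i, (0 : ℝ) < d i := fun i => by exact_mod_cast hd i
  have hdvd : ∀ l, d l ∣ ∏ i, d i := fun l => Finset.dvd_prod_of_mem d (Finset.mem_univ l)
  -- This makes `m = ∏ d i - 1` at least `1`; if all exponents were `1`, the sum would be `n ≥ 3`.
  have hD : 2 ≤ ∏ i, d i := by
    by_contra! hlt
    have hall : ∀ i, d i = 1 := fun i => by
      have h1 := Nat.le_of_dvd (Finset.prod_pos fun i _ => hd i) (hdvd i)
      have h2 := hd i
      omega
    have hn' : (3 : ℝ) ≤ n := by exact_mod_cast hn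
    simp [hall] at hsum
    linarith
  obtain ⟨m, hm⟩ : ∃ m, ∏ i, d i = m + 1 := ⟨∏ i, d i - 1, by omega⟩
  -- With these orders `c l * d l = m + 1` exactly, and `∑ c l = (m + 1) * ∑ 1 / d l ≤ m + 1`.
  refine not_isPrime_radical_jetIdeal (by omega) d hd hchar' (fun l => (∏ i, d i) / d l) ?_ ?_
    (h m (by omega))
  · intro l
    rw [Nat.div_mul_cancel (hdvd l), hm]
  · rw [← hm, ← Nat.cast_le (α := ℝ), Nat.cast_sum]
    calc ∑ l, (((∏ i, d i) / d l : ℕ) : ℝ) = (∏ i, d i : ℕ) * ∑ l, (1 : ℝ) / (d l : ℝ) := by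
          rw [Finset.mul_sum]
          refine Finset.sum_congr rfl fun l _ => ?_
          rw [Nat.cast_div (hdvd l) (hdpos l).ne', mul_one_div]
      _ ≤ _ := mul_le_of_le_one_right (Nat.cast_nonneg _) hsum
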